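/- All graphs are finite and simple. Let $h\ge 0$. For a graph $G$, a set $F\subseteq E(G)$ is an *$h$-extra edge-cut* if $G-F$ is disconnected and every component of $G-F$ has more than $h$ vertices; $\lambda^{(h)}(G)$ is the minimum cardinality of an $h$-extra edge-cut (it exists if there is at least one such cut). Let $\xi_h(G)$ be the minimum, over all vertex sets $X$ with $|X|=h+1$ for which $G[X]$ is connected, of the number of edges of $G$ with exactly one end in $X$. A connected graph $G$ is *super-$\lambda^{(h)}$* if $\lambda^{(h)}(G)$ exists, $\lambda^{(h)}(G)=\xi_h(G)$, and for every $h$-extra edge-cut $F$ with $|F|=\lambda^{(h)}(G)$ some component of $G-F$ has exactly $h+1$ vertices. The *persistence* $\rho^{(h)}(G)$ of a super-$\lambda^{(h)}$ graph $G$ is the maximum integer $k$ such that $G-F$ is super-$\lambda^{(h)}$ for every $F\subseteq E(G)$ with $|F|\le k$. Write $\lambda'=\lambda^{(1)}$, $\lambda''=\lambda^{(2)}$, $\rho'=\rho^{(1)}$. For integers $d\ge 2$ and $n\ge 1$, $G(n,d)$ is the graph with vertex set $\{0,1,\dots,n-1\}$ in which two distinct vertices $u,v$ are adjacent if and only if $v-u\equiv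 \pm d^i \pmod n$ for some integer $i$ with $0\le i\le \lceil\log_d n\rceil-1$. **Corollary.** Let $c,d,m$ be positive integers with $1<c<d$, $c\ne 3$, $d\ge 4$ and $m\ge 2$. Then the recursive circulant graph $G=G(cd^m,d)$ is super-$\lambda''$. Moreover $G$ is super-$\lambda'$, and its persistence is $\rho'(G)=2m$ if $c=2$ and $\rho'(G)=2m+1$ if $c\ge 4$. -/

import Mathlib

namespace ExtraEdge

variable {V : Type*} [Finite V]

/-- `F` is an `h`-extra edge-cut of `G`: a set of edges of `G` such that `G - F` is disconnected
and every component of `G - F` has more than `h` vertices. -/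
def IsExtraEdgeCut (G : SimpleGraph V) (h : ℕ) (F : Set (Sym2 V)) : Prop :=
  F ⊆ G.edgeSet ∧ ¬ (G.deleteEdges F).Preconnected ∧
    ∀ C : (G.deleteEdges F).ConnectedComponent, h < C.supp.ncard

/-- `l` is the `h`-extra edge-connectivity of `G`: the minimum cardinality of an `h`-extra
edge-cut. It holds for no `l` if `G` has no `h`-extra edge-cut. -/
def IsExtraEdgeConnectivity (G : SimpleGraph V) (h l : ℕ) : Prop :=
  IsLeast {k : ℕ | ∃ F : Set (Sym2 V), IsExtraEdgeCut G h F ∧ F.ncard = k} l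

/-- `[X, V ∖ X]`, the set of edges of `G` with exactly one end in `X`. -/
def edgeBoundary (G : SimpleGraph V) (X : Set V) : Set (Sym2 V) :=
  {e | ∃ u ∈ X, ∃ v ∉ X, G.Adj u v ∧ e = s(u, v)}

/-- `x` is `ξ_h(G)`: the minimum number of edges leaving a set of `h + 1` vertices that induces
a connected subgraph. -/
def IsMinBoundary (G : SimpleGraph V) (h x : ℕ) : Prop :=
  IsLeast {k : ℕ | ∃ X : Set V, X.ncard = h + 1 ∧ (G.induce X).Connected ∧
    (edgeBoundary G X).ncard = k} x

/-- `G` is `λ^(h)`-optimal: `λ^(h)(G)` exists and is equal to `ξ_h(G)`. -/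
def IsOptimal (G : SimpleGraph V) (h : ℕ) : Prop :=
  ∃ l : ℕ, IsExtraEdgeConnectivity G h l ∧ IsMinBoundary G h l

/-- `G` is super-`λ^(h)`: it is connected and `λ^(h)`-optimal, and for every minimum `h`-extra
edge-cut `F` some component of `G - F` has exactly `h + 1` vertices. -/
def IsSuper (G : SimpleGraph V) (h : ℕ) : Prop :=
  G.Connected ∧ IsOptimal G h ∧
    ∀ F : Set (Sym2 V), IsExtraEdgeCut G h F → IsExtraEdgeConnectivity G h F.ncard →
      ∃ C : (G.deleteEdges F).ConnectedComponent, C.supp.ncard = h + 1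

/-- `G` is super-`λ^(h)` and `r` is its persistence `ρ^(h)(G)`: the greatest `k` such that
`G - F` is super-`λ^(h)` for every set `F` of at most `k` edges of `G`. -/
def IsPersistence (G : SimpleGraph V) (h r : ℕ) : Prop :=
  IsSuper G h ∧
    IsGreatest {k : ℕ | ∀ F : Set (Sym2 V), F ⊆ G.edgeSet → F.ncard ≤ k →
      IsSuper (G.deleteEdges F) h} r

end ExtraEdge

/-- The graph `G(n, d)` on `{0, …, n - 1}`: distinct `u` and `v` are adjacent if and only if
`v - u ≡ ± d ^ i (mod n)` for some `0 ≤ i ≤ ⌈log_d n⌉ - 1`. -/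
def recursiveCirculant (n d : ℕ) : SimpleGraph (Fin n) :=
  SimpleGraph.fromRel fun u v : Fin n =>
    ∃ i < Nat.clog d n, (u : ℕ) + d ^ i ≡ (v : ℕ) [MOD n]

/-! Let `k` be the degree, `2 * m + 1` for `c = 2` and `2 * m + 2` for `c ≥ 4`. Everything follows
from isoperimetry: an edge boundary has at least `k` edges for a proper nonempty set, `3k - 4` for a
triple, and `3k - 3` when both sides have at least four vertices.

A path on three vertices has boundary at most `3k - 4`, which gives super-`λ''`. For `λ'`, delete a
set `F` of fewer than `k` edges: an edge at a vertex meeting `F` then has smaller boundary than any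
set with at least three vertices on each side (`isSuper_one_deleteEdges_of_isoperimetric`). Deleting
all edges at one vertex disconnects the graph, so the persistence is `k - 1`.

The bounds are proved by induction on `m` (`BoundaryBound.step`). The residue classes modulo `d`
carry `d` copies of the graph for `m - 1`, joined by the cycle of generator `1`. That cycle
contributes at least twice the difference of the numbers of chosen vertices in any two classes. The
base is an edge or a cycle of length at least four; for `c = 3` there are triangles, with boundary
only `3k - 6`. -/

namespace ExtraEdge

/-! ### Edge boundaries and components -/

section Boundary

variable {V : Type*} {G : SimpleGraph V}

theorem mk_mem_edgeBoundary {X : Set V} {u v : V} :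
    s(u, v) ∈ edgeBoundary G X ↔ G.Adj u v ∧ (u ∈ X ∧ v ∉ X ∨ v ∈ X ∧ u ∉ X) := by
  constructor
  · rintro ⟨a, ha, b, hb, hab, h⟩
    rcases Sym2.eq_iff.1 h with ⟨rfl, rfl⟩ | ⟨rfl, rfl⟩
    · exact ⟨hab, Or.inl ⟨ha, hb⟩⟩
    · exact ⟨hab.symm, Or.inr ⟨ha, hb⟩⟩
  · rintro ⟨hab, ⟨hu, hv⟩ | ⟨hv, hu⟩⟩
    · exact ⟨u, hu, v, hv, hab, rfl⟩
    · exact ⟨v, hv, u, hu, hab.symm, Sym2.eq_swap⟩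

theorem edgeBoundary_subset_edgeSet (X : Set V) : edgeBoundary G X ⊆ G.edgeSet := by
  rintro _ ⟨u, _, v, _, h, rfl⟩
  exact h

theorem edgeBoundary_deleteEdges (F : Set (Sym2 V)) (X : Set V) :
    edgeBoundary (G.deleteEdges F) X = edgeBoundary G X \ F := by
  ext e
  induction e with
  | h u v =>
    simp only [mk_mem_edgeBoundary, SimpleGraph.deleteEdges_adj, Set.mem_sdiff]
    tauto

theorem edgeBoundary_compl (X : Set V) : edgeBoundary G Xᶜ = edgeBoundary G X := by
  ext e
  induction e with
  | h u v =>
    simp only [mk_mem_edgeBoundary, Set.mem_compl_iff]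
    tauto

theorem edgeBoundary_supp_subset {F : Set (Sym2 V)} (C : (G.deleteEdges F).ConnectedComponent) :
    edgeBoundary G C.supp ⊆ F := by
  rintro _ ⟨u, hu, v, hv, h, rfl⟩
  by_contra hF
  exact hv (SimpleGraph.ConnectedComponent.mem_supp_of_adj_mem_supp C hu
    (SimpleGraph.deleteEdges_adj.2 ⟨h, hF⟩))

theorem edgeBoundary_union_supp_subset {X : Set V}
    (C : (G.deleteEdges (edgeBoundary G X)).ConnectedComponent) :
    edgeBoundary G (X ∪ C.supp) ⊆ edgeBoundary G X := by
  rintro _ ⟨u, hu, v, hv, h, rfl⟩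
  rcases hu with hu | hu
  · exact ⟨u, hu, v, fun h' => hv (Or.inl h'), h, rfl⟩
  · exact edgeBoundary_supp_subset C ⟨u, hu, v, fun h' => hv (Or.inr h'), h, rfl⟩

theorem mem_iff_of_reachable {X : Set V} {u v : V}
    (h : (G.deleteEdges (edgeBoundary G X)).Reachable u v) : u ∈ X ↔ v ∈ X := by
  obtain ⟨p⟩ := h
  induction p with
  | nil => rfl
  | cons h _ ih =>
    rw [← ih]
    rw [SimpleGraph.deleteEdges_adj, mk_mem_edgeBoundary] at h
    tauto

theorem reachable_of_induce_connected {X : Set V} (hX : (G.induce X).Connected) {u v : V}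
    (hu : u ∈ X) (hv : v ∈ X) : (G.deleteEdges (edgeBoundary G X)).Reachable u v := by
  have h : (G.induce X).Reachable ⟨u, hu⟩ ⟨v, hv⟩ := hX.preconnected _ _
  let f : G.induce X →g G.deleteEdges (edgeBoundary G X) :=
    { toFun := Subtype.val
      map_rel' := by
        rintro ⟨a, ha⟩ ⟨b, hb⟩ hab
        rw [SimpleGraph.deleteEdges_adj, mk_mem_edgeBoundary]
        exact ⟨hab, by tauto⟩ }
  exact h.map f

theorem edgeBoundary_nonempty (hG : G.Connected) {X : Set V} {u v : V} (hu : u ∈ X)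
    (hv : v ∉ X) : (edgeBoundary G X).Nonempty := by
  by_contra h
  rw [Set.not_nonempty_iff_eq_empty] at h
  have := mem_iff_of_reachable (G := G) (X := X) (u := u) (v := v)
    (by rw [h, SimpleGraph.deleteEdges_empty]; exact hG.preconnected u v)
  tauto

theorem connected_of_edgeBoundary_nonempty [Nonempty V]
    (h : ∀ X : Set V, X.Nonempty → Xᶜ.Nonempty → (edgeBoundary G X).Nonempty) :
    G.Connected := by
  refine ⟨fun u v => ?_⟩
  by_contra huv
  obtain ⟨_, a, ha, b, hb, hab, rfl⟩ := h {w | G.Reachable u w} ⟨u, .refl u⟩ ⟨v, huv⟩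
  exact hb (SimpleGraph.Reachable.trans ha hab.reachable)

theorem induce_supp_connected {F : Set (Sym2 V)} (C : (G.deleteEdges F).ConnectedComponent) :
    (G.induce C.supp).Connected :=
  SimpleGraph.Connected.mono (SimpleGraph.comap_monotone _ (G.deleteEdges_le F))
    C.connected_toSimpleGraph

theorem edgeBoundary_insert_subset (u : V) (X : Set V) :
    edgeBoundary G (insert u X) ⊆ edgeBoundary G {u} ∪ edgeBoundary G X := by
  intro e
  induction e with
  | h a b =>
    simp only [Set.mem_union, mk_mem_edgeBoundary, Set.mem_insert_iff, Set.mem_singleton_iff]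
    tauto

theorem exists_adj_of_connected [Nontrivial V] (hG : G.Connected) (u : V) : ∃ w, G.Adj u w := by
  obtain ⟨v, hv⟩ := exists_ne u
  obtain ⟨_, a, ha, w, -, h, rfl⟩ := edgeBoundary_nonempty hG (X := {u}) rfl hv
  rw [Set.mem_singleton_iff] at ha
  exact ⟨w, ha ▸ h⟩

variable [Finite V]

/-! ### Super edge-connectivity from boundary inequalities -/

/-- A component outside `Y` with at most `h` vertices could be absorbed into `Y` without enlarging
the boundary. The union has between `h + 2` and `2h + 1` vertices, so `3h + 3 ≤ |V|` makes `H`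
applicable, a contradiction. -/
theorem isExtraEdgeCut_edgeBoundary {h : ℕ} {Y : Set V} (hY : Y.ncard = h + 1)
    (hc : (G.induce Y).Connected) (hn : 3 * h + 3 ≤ Nat.card V)
    (H : ∀ X : Set V, h + 2 ≤ X.ncard → X.ncard + h + 2 ≤ Nat.card V →
      (edgeBoundary G Y).ncard < (edgeBoundary G X).ncard) :
    IsExtraEdgeCut G h (edgeBoundary G Y) := by
  have hYc : Yᶜ.ncard = Nat.card V - (h + 1) := by rw [Set.ncard_compl, hY]
  refine ⟨edgeBoundary_subset_edgeSet Y, fun hp => ?_, fun C => ?_⟩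
  · obtain ⟨u, hu⟩ := (Set.ncard_pos (s := Y)).1 (by omega)
    obtain ⟨v, hv⟩ := (Set.ncard_pos (s := Yᶜ)).1 (by omega)
    exact hv ((mem_iff_of_reachable (hp u v)).1 hu)
  · by_cases hm : ∃ u ∈ C.supp, u ∈ Y
    · obtain ⟨u, huC, huY⟩ := hm
      have hsub : Y ⊆ C.supp := fun v hv => by
        rw [SimpleGraph.ConnectedComponent.mem_supp_iff] at huC ⊢
        rw [← huC]
        exact SimpleGraph.ConnectedComponent.sound (reachable_of_induce_connected hc hv huY)
      have := Set.ncard_le_ncard hsub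
      omega
    · by_contra hC
      have hpos : 0 < C.supp.ncard := (Set.ncard_pos).2 C.nonempty_supp
      have hdisj : Disjoint Y C.supp :=
        Set.disjoint_left.2 fun u hY hC => hm ⟨u, hC, hY⟩
      have hcard := Set.ncard_union_eq hdisj
      have h1 := H (Y ∪ C.supp) (by omega) (by omega)
      have h2 := Set.ncard_le_ncard (edgeBoundary_union_supp_subset C)
      omega

/-- An extra edge-cut contains the boundaries of two components. Either one of them has `h + 1`
vertices, or `H` applies to the first and the cut is not minimum. -/
theorem isSuper_of_edgeBoundary_lt {h : ℕ} (hG : G.Connected) (hn : 3 * h + 3 ≤ Nat.card V)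
    (hex : ∃ Y : Set V, Y.ncard = h + 1 ∧ (G.induce Y).Connected)
    (H : ∀ X : Set V, h + 2 ≤ X.ncard → X.ncard + h + 2 ≤ Nat.card V →
      ∃ Y : Set V, Y.ncard = h + 1 ∧ (G.induce Y).Connected ∧
        (edgeBoundary G Y).ncard < (edgeBoundary G X).ncard) :
    IsSuper G h := by
  classical
  have hne : ∃ k, ∃ X : Set V, X.ncard = h + 1 ∧ (G.induce X).Connected ∧
      (edgeBoundary G X).ncard = k := by
    obtain ⟨Y, h1, h2⟩ := hex
    exact ⟨_, Y, h1, h2, rfl⟩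
  obtain ⟨Y, hY, hYc, hYk⟩ := Nat.find_spec hne
  have hmin : ∀ X : Set V, X.ncard = h + 1 → (G.induce X).Connected →
      Nat.find hne ≤ (edgeBoundary G X).ncard := fun X h1 h2 => Nat.find_min' hne ⟨X, h1, h2, rfl⟩
  set l := Nat.find hne
  have hlt : ∀ X : Set V, h + 2 ≤ X.ncard → X.ncard + h + 2 ≤ Nat.card V →
      l < (edgeBoundary G X).ncard := fun X h1 h2 => by
    obtain ⟨Z, hZ, hZc, hZX⟩ := H X h1 h2
    exact (hmin Z hZ hZc).trans_lt hZX
  have hcut : ∀ F : Set (Sym2 V), IsExtraEdgeCut G h F → l ≤ F.ncard ∧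
      (F.ncard = l → ∃ C : (G.deleteEdges F).ConnectedComponent, C.supp.ncard = h + 1) := by
    rintro F ⟨-, hF, hC⟩
    simp only [SimpleGraph.Preconnected, not_forall] at hF
    obtain ⟨u, v, huv⟩ := hF
    set C := (G.deleteEdges F).connectedComponentMk u
    set D := (G.deleteEdges F).connectedComponentMk v
    have hCD : C ≠ D := fun h => huv (SimpleGraph.ConnectedComponent.exact h)
    have hdisj : Disjoint C.supp D.supp :=
      SimpleGraph.pairwise_disjoint_supp_connectedComponent _ hCD
    have hcard := Set.ncard_union_eq hdisj
    have htot := Set.ncard_le_card (C.supp ∪ D.supp)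
    have hC1 := hC C
    have hD1 := hC D
    have hFC : (edgeBoundary G C.supp).ncard ≤ F.ncard :=
      Set.ncard_le_ncard (edgeBoundary_supp_subset C)
    have hFD : (edgeBoundary G D.supp).ncard ≤ F.ncard :=
      Set.ncard_le_ncard (edgeBoundary_supp_subset D)
    by_cases h1 : C.supp.ncard = h + 1
    · exact ⟨(hmin _ h1 (induce_supp_connected C)).trans hFC, fun _ => ⟨C, h1⟩⟩
    by_cases h2 : D.supp.ncard = h + 1
    · exact ⟨(hmin _ h2 (induce_supp_connected D)).trans hFD, fun _ => ⟨D, h2⟩⟩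
    have := hlt C.supp (by omega) (by omega)
    exact ⟨by omega, fun h => by omega⟩
  have hl : IsExtraEdgeConnectivity G h l := by
    refine ⟨⟨edgeBoundary G Y, ?_, hYk⟩, ?_⟩
    · exact isExtraEdgeCut_edgeBoundary hY hYc hn (by rwa [hYk])
    · rintro _ ⟨F, hF, rfl⟩
      exact (hcut F hF).1
  refine ⟨hG, ⟨l, hl, ⟨Y, hY, hYc, hYk⟩, ?_⟩, fun F hF hFl => ?_⟩
  · rintro _ ⟨X, h1, h2, rfl⟩
    exact hmin X h1 h2
  · exact (hcut F hF).2 (hFl.unique hl)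

/-- The edge `uv` counts on both terms of the right side but becomes internal to the union. -/
theorem ncard_edgeBoundary_insert_add_two_le {u v : V} {X : Set V} (h : G.Adj u v) (hu : u ∉ X)
    (hv : v ∈ X) :
    (edgeBoundary G (insert u X)).ncard + 2 ≤
      (edgeBoundary G {u}).ncard + (edgeBoundary G X).ncard := by
  have hne := h.ne
  have hu' : s(u, v) ∈ edgeBoundary G {u} := mk_mem_edgeBoundary.2 ⟨h, by simp [hne.symm]⟩
  have hv' : s(u, v) ∈ edgeBoundary G X := mk_mem_edgeBoundary.2 ⟨h, by tauto⟩
  have hsub : edgeBoundary G (insert u X) ⊆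
      (edgeBoundary G {u} \ {s(u, v)}) ∪ (edgeBoundary G X \ {s(u, v)}) := by
    intro e he
    have hne' : e ≠ s(u, v) := by
      rintro rfl
      simp [mk_mem_edgeBoundary, hv] at he
    rcases edgeBoundary_insert_subset u X he with h | h
    · exact Or.inl ⟨h, hne'⟩
    · exact Or.inr ⟨h, hne'⟩
  have h1 := Set.ncard_le_ncard hsub
  have h2 := Set.ncard_union_le (edgeBoundary G {u} \ {s(u, v)}) (edgeBoundary G X \ {s(u, v)})
  have h3 := Set.ncard_sdiff_singleton_add_one hu'
  have h4 := Set.ncard_sdiff_singleton_add_one hv'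
  omega

theorem ncard_edgeBoundary_pair_add_two_le {u v : V} (h : G.Adj u v) :
    (edgeBoundary G {u, v}).ncard + 2 ≤
      (edgeBoundary G {u}).ncard + (edgeBoundary G {v}).ncard :=
  ncard_edgeBoundary_insert_add_two_le h h.ne rfl

theorem exists_two_adj {u : V} (h : 2 ≤ (edgeBoundary G {u}).ncard) :
    ∃ v w, v ≠ w ∧ G.Adj u v ∧ G.Adj u w := by
  obtain ⟨e, f, he, hf, hne⟩ := (Set.one_lt_ncard_iff).1 h
  obtain ⟨a, ha, v, -, hv, rfl⟩ := he
  obtain ⟨b, hb, w, -, hw, rfl⟩ := hf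
  rw [Set.mem_singleton_iff] at ha hb
  subst ha hb
  exact ⟨v, w, fun h => hne (h ▸ rfl), hv, hw⟩

theorem exists_ncard_eq_three {k : ℕ} (hk : 2 ≤ k) (hdeg : ∀ u : V, (edgeBoundary G {u}).ncard = k)
    [Nonempty V] : ∃ Y : Set V, Y.ncard = 3 ∧ (G.induce Y).Connected ∧
      (edgeBoundary G Y).ncard + 4 ≤ 3 * k := by
  obtain ⟨u⟩ := ‹Nonempty V›
  obtain ⟨v, w, hvw, hv, hw⟩ := exists_two_adj ((hdeg u).symm ▸ hk)
  have hwn : w ∉ ({u, v} : Set V) := by simp [hvw.symm, hw.ne.symm]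
  refine ⟨insert w {u, v}, ?_, ?_, ?_⟩
  · rw [Set.ncard_insert_of_notMem hwn, Set.ncard_pair hv.ne]
  · exact SimpleGraph.connected_induce_union (s := {w}) (v := w) (w := u) .of_subsingleton
      (SimpleGraph.induce_pair_connected_of_adj hv).preconnected rfl (by simp) hw.symm
  · have h1 := ncard_edgeBoundary_insert_add_two_le hw.symm hwn (by simp)
    have h2 := ncard_edgeBoundary_pair_add_two_le hv
    rw [hdeg] at h1 h2
    rw [hdeg] at h2
    omega

/-! ### From isoperimetry to super-connectivity and persistence -/

section Regular

variable {k : ℕ} (hk : 5 ≤ k) (hdeg : ∀ u : V, (edgeBoundary G {u}).ncard ≤ k)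
  (h1 : ∀ X : Set V, 1 ≤ X.ncard → X.ncard + 1 ≤ Nat.card V → k ≤ (edgeBoundary G X).ncard)
  (h3 : ∀ X : Set V, X.ncard = 3 → 3 * k ≤ (edgeBoundary G X).ncard + 4)
  (h4 : ∀ X : Set V, 4 ≤ X.ncard → X.ncard + 4 ≤ Nat.card V →
    3 * k ≤ (edgeBoundary G X).ncard + 3)
  (hn : 9 ≤ Nat.card V)

include h1 in
theorem connected_deleteEdges_of_ncard_lt [Nonempty V] {F : Set (Sym2 V)} (hF : F.ncard < k) :
    (G.deleteEdges F).Connected := by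
  refine connected_of_edgeBoundary_nonempty fun X hX hXc => ?_
  rw [edgeBoundary_deleteEdges, ← Set.ncard_pos]
  have ha := (Set.ncard_pos).2 hX
  have hb := (Set.ncard_pos).2 hXc
  rw [Set.ncard_compl] at hb
  have := h1 X ha (by omega)
  have := Set.le_ncard_sdiff F (edgeBoundary G X)
  omega

include hk hdeg h1 h4 hn in
theorem isSuper_two_of_isoperimetric : IsSuper G 2 := by
  have : Nonempty V := (Nat.card_pos_iff.1 (by omega)).1
  have hG : G.Connected := by
    have := connected_deleteEdges_of_ncard_lt h1 (F := ∅) (by simp; omega)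
    rwa [SimpleGraph.deleteEdges_empty] at this
  have hdeg' : ∀ u : V, (edgeBoundary G {u}).ncard = k := fun u =>
    (hdeg u).antisymm (h1 {u} (by simp) (by simp; omega))
  obtain ⟨Y, hY, hYc, hYk⟩ := exists_ncard_eq_three (by omega) hdeg'
  refine isSuper_of_edgeBoundary_lt hG hn ⟨Y, hY, hYc⟩ fun X ha hb => ⟨Y, hY, hYc, ?_⟩
  have := h4 X ha hb
  omega

theorem ncard_edgeBoundary_sdiff (F : Set (Sym2 V)) (X : Set V) :
    (edgeBoundary (G.deleteEdges F) X).ncard + (edgeBoundary G X ∩ F).ncard =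
      (edgeBoundary G X).ncard := by
  rw [edgeBoundary_deleteEdges, add_comm, Set.ncard_inter_add_ncard_sdiff_eq_ncard]

theorem exists_two_le_ncard_inter {F : Set (Sym2 V)} {Y : Set V} (hY : Y.ncard = 3)
    (hF : F ⊆ edgeBoundary G Y) (hF4 : 4 ≤ F.ncard) :
    ∃ a, 2 ≤ (edgeBoundary G {a} ∩ F).ncard := by
  by_contra! h
  obtain ⟨x, y, z, -, -, -, rfl⟩ := Set.ncard_eq_three.1 hY
  have hsub : F ⊆ (edgeBoundary G {x} ∩ F) ∪
      ((edgeBoundary G {y} ∩ F) ∪ (edgeBoundary G {z} ∩ F)) := by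
    intro e he
    rcases edgeBoundary_insert_subset _ _ (hF he) with h | h
    · exact Or.inl ⟨h, he⟩
    rcases edgeBoundary_insert_subset _ _ h with h | h
    · exact Or.inr (Or.inl ⟨h, he⟩)
    · exact Or.inr (Or.inr ⟨h, he⟩)
  have ha := Set.ncard_le_ncard hsub
  have hb := Set.ncard_union_le (edgeBoundary G {x} ∩ F)
    ((edgeBoundary G {y} ∩ F) ∪ (edgeBoundary G {z} ∩ F))
  have hc := Set.ncard_union_le (edgeBoundary G {y} ∩ F) (edgeBoundary G {z} ∩ F)
  have hx := h x
  have hy := h y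
  have hz := h z
  omega

include hdeg in
theorem exists_adj_ncard_edgeBoundary_pair_le [Nontrivial V] {F : Set (Sym2 V)}
    (hG : (G.deleteEdges F).Connected) (u : V) :
    ∃ w, (G.deleteEdges F).Adj u w ∧
      (edgeBoundary (G.deleteEdges F) {u, w}).ncard + (edgeBoundary G {u} ∩ F).ncard + 2 ≤
        2 * k := by
  obtain ⟨w, hw⟩ := exists_adj_of_connected hG u
  refine ⟨w, hw, ?_⟩
  have ha := ncard_edgeBoundary_pair_add_two_le hw
  have hb := ncard_edgeBoundary_sdiff (G := G) F {u}
  have hc := ncard_edgeBoundary_sdiff (G := G) F {w}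
  have hd := hdeg u
  have he := hdeg w
  omega

include hk hdeg h1 h3 h4 hn in
-- An edge at `u` has boundary at most `2k - 2` minus the number of deleted edges at `u`, while `X`
-- keeps at least `3k - 4 - (k - 1) = 2k - 3` edges. The choice of `u` depends on how tight the
-- latter is.
theorem isSuper_one_deleteEdges_of_isoperimetric {F : Set (Sym2 V)} (hFG : F ⊆ G.edgeSet)
    (hF : F.ncard < k) : IsSuper (G.deleteEdges F) 1 := by
  have : Nontrivial V := (Finite.one_lt_card_iff_nontrivial).1 (by omega)
  have hG := connected_deleteEdges_of_ncard_lt h1 hF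
  suffices H : ∀ X : Set V, 3 ≤ X.ncard → X.ncard + 3 ≤ Nat.card V →
      ∃ u w, (G.deleteEdges F).Adj u w ∧ (edgeBoundary (G.deleteEdges F) {u, w}).ncard <
        (edgeBoundary (G.deleteEdges F) X).ncard by
    refine isSuper_of_edgeBoundary_lt hG (by omega) ?_ fun X ha hb => ?_
    · obtain ⟨u⟩ := hG.nonempty
      obtain ⟨w, hw⟩ := exists_adj_of_connected hG u
      exact ⟨{u, w}, Set.ncard_pair hw.ne, SimpleGraph.induce_pair_connected_of_adj hw⟩
    · obtain ⟨u, w, hw, hlt⟩ := H X ha hb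
      exact ⟨{u, w}, Set.ncard_pair hw.ne, SimpleGraph.induce_pair_connected_of_adj hw, hlt⟩
  intro X ha hb
  have hX := ncard_edgeBoundary_sdiff (G := G) F X
  have hXF : (edgeBoundary G X ∩ F).ncard ≤ F.ncard := Set.ncard_le_ncard Set.inter_subset_right
  have hsmall : X.ncard = 3 ∨ X.ncard + 3 = Nat.card V →
      ∃ Y : Set V, Y.ncard = 3 ∧ edgeBoundary G Y = edgeBoundary G X := by
    rintro (h | h)
    · exact ⟨X, h, rfl⟩
    · exact ⟨Xᶜ, by rw [Set.ncard_compl]; omega, edgeBoundary_compl X⟩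
  have hX3 : 3 * k ≤ (edgeBoundary G X).ncard + 4 := by
    by_cases h : X.ncard = 3 ∨ X.ncard + 3 = Nat.card V
    · obtain ⟨Y, hY, hYX⟩ := hsmall h
      exact hYX ▸ h3 Y hY
    · have := h4 X (by omega) (by omega)
      omega
  rcases F.eq_empty_or_nonempty with rfl | ⟨f, hf⟩
  · obtain ⟨u⟩ := hG.nonempty
    obtain ⟨w, hw, hlt⟩ := exists_adj_ncard_edgeBoundary_pair_le hdeg hG u
    simp only [Set.inter_empty, Set.ncard_empty] at hX hlt
    exact ⟨u, w, hw, by omega⟩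
  -- Only here can `X` drop to `2k - 3`. Then `F` has `k - 1 ≥ 4` edges leaving a triple, so two of
  -- them share a vertex of the triple, and an edge there has boundary at most `2k - 4`.
  by_cases hall : edgeBoundary G X ∩ F = F ∧ F.ncard + 1 = k ∧
      (X.ncard = 3 ∨ X.ncard + 3 = Nat.card V)
  · obtain ⟨hFX, hFk, hs⟩ := hall
    obtain ⟨Y, hY, hYX⟩ := hsmall hs
    obtain ⟨a, haF⟩ := exists_two_le_ncard_inter (F := F) hY
      (hYX ▸ Set.inter_eq_right.1 hFX) (by omega)
    obtain ⟨w, hw, hlt⟩ := exists_adj_ncard_edgeBoundary_pair_le hdeg hG a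
    exact ⟨a, w, hw, by omega⟩
  · have hX2 : 2 * k ≤ (edgeBoundary (G.deleteEdges F) X).ncard + 2 := by
      by_cases hs : X.ncard = 3 ∨ X.ncard + 3 = Nat.card V
      · have : (edgeBoundary G X ∩ F).ncard + 1 < k := by
          by_contra hlt
          refine hall ⟨Set.eq_of_subset_of_ncard_le Set.inter_subset_right ?_, ?_, hs⟩ <;> omega
        omega
      · have := h4 X (by omega) (by omega)
        omega
    induction f with
    | h u v =>
      have huv : G.Adj u v := hFG hf
      have hpos : 0 < (edgeBoundary G {u} ∩ F).ncard :=
        (Set.ncard_pos).2 ⟨s(u, v), mk_mem_edgeBoundary.2 ⟨huv, by simp [huv.ne.symm]⟩, hf⟩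
      obtain ⟨w, hw, hlt⟩ := exists_adj_ncard_edgeBoundary_pair_le hdeg hG u
      exact ⟨u, w, hw, by omega⟩

include hk hdeg h1 h3 h4 hn in
theorem isPersistence_one_of_isoperimetric : IsPersistence G 1 (k - 1) := by
  have key := fun F hFG => isSuper_one_deleteEdges_of_isoperimetric hk hdeg h1 h3 h4 hn (F := F) hFG
  refine ⟨?_, fun F hFG hF => key F hFG (by omega), fun r hr => ?_⟩
  · simpa using key ∅ (Set.empty_subset _) (by simp; omega)
  · by_contra hlt
    have : Nontrivial V := (Finite.one_lt_card_iff_nontrivial).1 (by omega)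
    obtain ⟨u, v, huv⟩ := exists_pair_ne V
    have hu := hdeg u
    have hs := hr (edgeBoundary G {u}) (edgeBoundary_subset_edgeSet _) (by omega)
    exact huv ((mem_iff_of_reachable (hs.1.preconnected u v)).1 rfl).symm

end Regular

end Boundary

/-! ### Isoperimetry of periodic 0-1 sequences -/

section Isoperimetry

open Finset

/-- The number of `j < N` with `X j`. -/
def periodCard (N : ℕ) (X : ℕ → Bool) : ℕ := ∑ j ∈ range N, (X j).toNat

/-- The number of `j < N` at which `X` changes from `j` to `j + s`. -/
def flips (s N : ℕ) (X : ℕ → Bool) : ℕ := ∑ j ∈ range N, (X j ^^ X (j + s)).toNat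

/-- The boundary of the set `X` of residues modulo `c * d ^ m` in the recursive circulant graph,
by the decomposition into residue classes modulo `d`. The last generator is only used `L` times
per residue class. -/
def circulantBoundary (c d L : ℕ) : ℕ → (ℕ → Bool) → ℕ
  | 0, X => flips 1 L X
  | m + 1, X => flips 1 (c * d ^ (m + 1)) X +
      ∑ r ∈ range d, circulantBoundary c d L m fun j => X (d * j + r)

theorem sum_range_mul_eq (f : ℕ → ℕ) (N d : ℕ) :
    ∑ j ∈ range (N * d), f j = ∑ r ∈ range d, ∑ j ∈ range N, f (d * j + r) := by
  induction N with
  | zero => simp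
  | succ N ih =>
    rw [Nat.succ_mul, sum_range_add, ih, ← sum_add_distrib]
    exact sum_congr rfl fun r _ => by rw [sum_range_succ, mul_comm d N]

theorem periodCard_mul (N d : ℕ) (X : ℕ → Bool) :
    periodCard (N * d) X = ∑ r ∈ range d, periodCard N fun j => X (d * j + r) :=
  sum_range_mul_eq _ N d

theorem flips_mul (s N d : ℕ) (X : ℕ → Bool) :
    flips (s * d) (N * d) X = ∑ r ∈ range d, flips s N fun j => X (d * j + r) := by
  unfold flips
  rw [sum_range_mul_eq]
  refine sum_congr rfl fun r _ => sum_congr rfl fun j _ => ?_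
  rw [show d * j + r + s * d = d * (j + s) + r by ring]

theorem circulantBoundary_eq_sum (c d L m : ℕ) (X : ℕ → Bool) :
    circulantBoundary c d L m X =
      ∑ i ∈ range m, flips (d ^ i) (c * d ^ m) X + flips (d ^ m) (L * d ^ m) X := by
  induction m generalizing X with
  | zero => simp [circulantBoundary]
  | succ m ih =>
    rw [circulantBoundary, sum_congr rfl fun r _ => ih _, sum_add_distrib, sum_comm,
      sum_range_succ', pow_zero]
    simp only [pow_succ, ← mul_assoc, flips_mul]
    ring

theorem periodCard_le (N : ℕ) (X : ℕ → Bool) : periodCard N X ≤ N := by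
  calc periodCard N X ≤ ∑ _j ∈ range N, 1 := sum_le_sum fun j _ => Bool.toNat_le _
    _ = N := by simp

theorem periodCard_not (N : ℕ) (X : ℕ → Bool) :
    periodCard N (fun j => !X j) + periodCard N X = N := by
  unfold periodCard
  rw [← sum_add_distrib, sum_congr rfl (g := fun _ => 1) fun j _ => by
    cases h : X j <;> simp [h]]
  simp

theorem flips_not (s N : ℕ) (X : ℕ → Bool) : flips s N (fun j => !X j) = flips s N X := by
  simp [flips]

theorem periodCard_shift {N : ℕ} {X : ℕ → Bool} (hX : ∀ j, X (j + N) = X j) :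
    periodCard N (fun j => X (j + 1)) = periodCard N X := by
  unfold periodCard
  have h1 := sum_range_succ' (fun j => (X j).toNat) N
  have h2 := sum_range_succ (fun j => (X j).toNat) N
  have h0 := hX 0
  rw [zero_add] at h0
  rw [h0] at h2
  exact Nat.add_right_cancel (h1.symm.trans h2)

/-- The number of `j < N` with `X j` and not `X (j + 1)`. -/
def descents (N : ℕ) (X : ℕ → Bool) : ℕ := ∑ j ∈ range N, (X j && !X (j + 1)).toNat

theorem flips_one_eq_two_mul_descents {N : ℕ} {X : ℕ → Bool} (hX : ∀ j, X (j + N) = X j) :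
    flips 1 N X = 2 * descents N X := by
  have h : flips 1 N X + periodCard N X = 2 * descents N X + periodCard N (fun j => X (j + 1)) := by
    simp only [flips, periodCard, descents, mul_sum, ← sum_add_distrib]
    exact sum_congr rfl fun j _ => by cases X j <;> cases X (j + 1) <;> rfl
  rw [periodCard_shift hX] at h
  omega

theorem periodCard_le_add_descents (N : ℕ) (X Y : ℕ → Bool) :
    periodCard N X ≤ periodCard N Y + ∑ j ∈ range N, (X j && !Y j).toNat := by
  simp only [periodCard, ← sum_add_distrib]
  exact sum_le_sum fun j _ => by cases X j <;> cases Y j <;> decide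

/-- Moving from one class to the next loses only elements at descents, and different moves use
descents in different classes. -/
theorem periodCard_class_le {N d : ℕ} {X : ℕ → Bool} {r s : ℕ} (hrs : r ≤ s) (hs : s < d) :
    periodCard N (fun j => X (d * j + r)) ≤
      periodCard N (fun j => X (d * j + s)) + descents (N * d) X := by
  have key : ∀ t, periodCard N (fun j => X (d * j + r)) ≤
      periodCard N (fun j => X (d * j + (r + t))) +
        ∑ i ∈ Ico r (r + t), ∑ j ∈ range N, (X (d * j + i) && !X (d * j + i + 1)).toNat := by
    intro t
    induction t with
    | zero => simp
    | succ t ih =>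
      rw [← add_assoc, sum_Ico_succ_top (by omega)]
      have := periodCard_le_add_descents N (fun j => X (d * j + (r + t)))
        (fun j => X (d * j + (r + t) + 1))
      simp only [← add_assoc] at this ih ⊢
      omega
  have h := key (s - r)
  rw [Nat.add_sub_cancel' hrs] at h
  refine h.trans (Nat.add_le_add_left ?_ _)
  rw [descents, sum_range_mul_eq, ← Nat.Ico_zero_eq_range]
  refine sum_le_sum_of_subset fun i hi => ?_
  rw [mem_Ico] at hi
  rw [mem_range]
  omega

theorem two_mul_periodCard_class_le {N d : ℕ} {X : ℕ → Bool} (hX : ∀ j, X (j + N * d) = X j)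
    {r s : ℕ} (hr : r < d) (hs : s < d) :
    2 * periodCard N (fun j => X (d * j + r)) ≤
      2 * periodCard N (fun j => X (d * j + s)) + flips 1 (N * d) X := by
  rcases le_total r s with h | h
  · have := periodCard_class_le (N := N) (X := X) h hs
    rw [flips_one_eq_two_mul_descents hX]
    omega
  · have := periodCard_class_le (N := N) (X := fun j => !X j) h hr
    have h1 := periodCard_not N fun j => X (d * j + r)
    have h2 := periodCard_not N fun j => X (d * j + s)
    rw [← flips_not, flips_one_eq_two_mul_descents fun j => by rw [hX]]
    omega

theorem two_le_flips {N : ℕ} {X : ℕ → Bool} (hX : ∀ j, X (j + N) = X j)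
    (h1 : 1 ≤ periodCard N X) (h2 : periodCard N X + 1 ≤ N) : 2 ≤ flips 1 N X := by
  by_contra h
  have h0 := flips_one_eq_two_mul_descents hX
  have hz : flips 1 N X = 0 := by omega
  have hstep : ∀ j < N, X (j + 1) = X j := by
    intro j hj
    have := (sum_eq_zero_iff.1 hz) j (mem_range.2 hj)
    revert this
    cases X j <;> cases X (j + 1) <;> simp
  have hconst : ∀ j ≤ N, X j = X 0 := by
    intro j hj
    induction j with
    | zero => rfl
    | succ j ih => rw [hstep j hj, ih (by omega)]
  have hc : periodCard N X = N * (X 0).toNat := by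
    rw [periodCard, sum_congr rfl fun j hj => by rw [hconst j (mem_range.1 hj).le]]
    simp
  cases hX0 : X 0 <;> simp [hX0] at hc <;> omega

/-- The lower bounds on the boundary `e` of a set of `x` vertices in a `k`-regular recursive
circulant graph with `N` vertices. -/
structure BoundaryBound (k N x e : ℕ) : Prop where
  one : 1 ≤ x → x + 1 ≤ N → k ≤ e
  two : 2 ≤ x → x + 2 ≤ N → 2 * k ≤ e + 2
  three : x = 3 ∨ x + 3 = N → 3 * k ≤ e + 4
  -- The second alternative is needed for small `k`, as for long cycles with `k = 2`; once `k ≥ 5`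
  -- it implies the first.
  four : 4 ≤ x → x + 4 ≤ N → 3 * k ≤ e + 3 ∨ 4 * k ≤ e + 8

theorem BoundaryBound.compl {k N x y e : ℕ} (h : BoundaryBound k N x e) (hxy : y + x = N) :
    BoundaryBound k N y e :=
  ⟨fun h1 h2 => h.one (by omega) (by omega), fun h1 h2 => h.two (by omega) (by omega),
    fun h1 => h.three (by omega), fun h1 h2 => h.four (by omega) (by omega)⟩

/-- The cases follow the number of nonempty classes. Below four, some class is empty, so `B` is at
least twice every `x r`; from four on, these classes alone give `4k`. -/
theorem BoundaryBound.step_of_not_full {k N d B : ℕ} {x e : ℕ → ℕ} (hk : 1 ≤ k) (hN : 2 * k ≤ N)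
    (hd : 4 ≤ d) (hfull : ∀ r < d, x r + 1 ≤ N)
    (hb : ∀ r < d, BoundaryBound k N (x r) (e r))
    (hB : ∀ r < d, ∀ s < d, 2 * x r ≤ 2 * x s + B)
    (hB2 : 1 ≤ ∑ r ∈ range d, x r → 2 ≤ B) :
    BoundaryBound (k + 2) (N * d) (∑ r ∈ range d, x r) (B + ∑ r ∈ range d, e r) := by
  classical
  set T := (range d).filter fun r => 1 ≤ x r with hT
  have hTx : ∑ r ∈ range d, x r = ∑ r ∈ T, x r :=
    (sum_filter_of_ne fun r _ h => Nat.one_le_iff_ne_zero.2 h).symm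
  have hTe : ∑ r ∈ T, e r ≤ ∑ r ∈ range d, e r := sum_le_sum_of_subset (filter_subset _ _)
  have hTmem : ∀ r ∈ T, r < d ∧ 1 ≤ x r := fun r hr => by
    rw [hT, mem_filter, mem_range] at hr
    exact hr
  have hTk : #T * k ≤ ∑ r ∈ T, e r := by
    rw [← smul_eq_mul]
    exact card_nsmul_le_sum _ _ _ fun r hr =>
      (hb r (hTmem r hr).1).one (hTmem r hr).2 (hfull r (hTmem r hr).1)
  have hNd : N * 4 ≤ N * d := Nat.mul_le_mul_left N hd
  have hempty : #T < 4 → ∀ r ∈ T, 2 * x r ≤ B := by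
    intro h4 r hr
    obtain ⟨s, hs, hsT⟩ : ∃ s ∈ range d, s ∉ T :=
      exists_mem_notMem_of_card_lt_card (by rw [card_range]; omega)
    have hs0 : x s = 0 := by
      by_contra h
      exact hsT (mem_filter.2 ⟨hs, by omega⟩)
    have := hB r (hTmem r hr).1 s (mem_range.1 hs)
    omega
  rw [hTx] at hB2 ⊢
  rcases (by omega : #T = 0 ∨ #T = 1 ∨ #T = 2 ∨ #T = 3 ∨ 4 ≤ #T) with h | h | h | h | h
  · rw [card_eq_zero] at h
    rw [h, sum_empty]
    exact ⟨by omega, by omega, by omega, by omega⟩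
  · obtain ⟨r, hr⟩ := card_eq_one.1 h
    have hrT : r ∈ T := by simp [hr]
    have hBr := hempty (by omega) r hrT
    obtain ⟨hrd, hr1⟩ := hTmem r hrT
    obtain ⟨b1, b2, b3, b4⟩ := hb r hrd
    have := hfull r hrd
    rw [hr, sum_singleton] at hTe hB2 ⊢
    exact ⟨by omega, by omega, by omega, by omega⟩
  · obtain ⟨r, s, hrs, hT2⟩ := card_eq_two.1 h
    have hrT : r ∈ T := by simp [hT2]
    have hsT : s ∈ T := by simp [hT2]
    have hBr := hempty (by omega) r hrT
    have hBs := hempty (by omega) s hsT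
    obtain ⟨hrd, hr1⟩ := hTmem r hrT
    obtain ⟨hsd, hs1⟩ := hTmem s hsT
    obtain ⟨b1, b2, b3, b4⟩ := hb r hrd
    obtain ⟨c1, c2, c3, c4⟩ := hb s hsd
    have := hfull r hrd
    have := hfull s hsd
    have hr2 : x r = 2 → 2 * k ≤ e r + 2 := fun _ => by clear c1 c2 c3 c4; omega
    have hs2 : x s = 2 → 2 * k ≤ e s + 2 := fun _ => by clear b1 b2 b3 b4; omega
    have hr3 : 3 ≤ x r → 3 * k ≤ e r + B := fun _ => by clear c1 c2 c3 c4; omega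
    have hs3 : 3 ≤ x s → 3 * k ≤ e s + B := fun _ => by clear b1 b2 b3 b4; omega
    rw [hT2, sum_pair hrs] at hTe hB2 ⊢
    have hrk := b1 hr1 ‹_›
    have hsk := c1 hs1 ‹_›
    have hB := hB2 (by omega)
    clear b1 b2 b3 b4 c1 c2 c3 c4 hB2
    refine ⟨by omega, by omega, fun h => ?_, fun h _ => Or.inr ?_⟩
    · rcases (by omega : x r = 2 ∨ x s = 2) with h | h
      · have := hr2 h
        omega
      · have := hs2 h
        omega
    · rcases (by omega : 3 ≤ x r ∨ 3 ≤ x s ∨ x r = 2 ∧ x s = 2) with h | h | ⟨h, h'⟩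
      · have := hr3 h
        omega
      · have := hs3 h
        omega
      · have := hr2 h
        have := hs2 h'
        omega
  · obtain ⟨r, s, t, hrs, hrt, hst, hT3⟩ := card_eq_three.1 h
    have hrT : r ∈ T := by simp [hT3]
    have hsT : s ∈ T := by simp [hT3]
    have htT : t ∈ T := by simp [hT3]
    have hBr := hempty (by omega) r hrT
    have hBs := hempty (by omega) s hsT
    have hBt := hempty (by omega) t htT
    obtain ⟨hrd, hr1⟩ := hTmem r hrT
    obtain ⟨hsd, hs1⟩ := hTmem s hsT
    obtain ⟨htd, ht1⟩ := hTmem t htT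
    obtain ⟨b1, b2, -, -⟩ := hb r hrd
    obtain ⟨c1, c2, -, -⟩ := hb s hsd
    obtain ⟨d1, d2, -, -⟩ := hb t htd
    have := hfull r hrd
    have := hfull s hsd
    have := hfull t htd
    have hr2 : 2 ≤ x r → 2 * k ≤ e r + B := fun _ => by clear c1 c2 d1 d2; omega
    have hs2 : 2 ≤ x s → 2 * k ≤ e s + B := fun _ => by clear b1 b2 d1 d2; omega
    have ht2 : 2 ≤ x t → 2 * k ≤ e t + B := fun _ => by clear b1 b2 c1 c2; omega
    rw [hT3, sum_insert (by simp [hrs, hrt]), sum_pair hst] at hTe hB2 ⊢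
    have hrk := b1 hr1 ‹_›
    have hsk := c1 hs1 ‹_›
    have htk := d1 ht1 ‹_›
    have hB := hB2 (by omega)
    clear b1 b2 c1 c2 d1 d2 hB2
    refine ⟨by omega, by omega, by omega, fun h _ => Or.inr ?_⟩
    rcases (by omega : 2 ≤ x r ∨ 2 ≤ x s ∨ 2 ≤ x t) with h | h | h
    · have := hr2 h
      omega
    · have := hs2 h
      omega
    · have := ht2 h
      omega
  · have h1 : #T ≤ ∑ r ∈ T, x r := by
      rw [card_eq_sum_ones]
      exact sum_le_sum fun r hr => (hTmem r hr).2
    have h4k : 4 * k ≤ #T * k := Nat.mul_le_mul_right k h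
    have := hB2 (by omega)
    exact ⟨by omega, by omega, by omega, by omega⟩

theorem BoundaryBound.step {k N d B : ℕ} {x e : ℕ → ℕ} (hk : 1 ≤ k) (hN : 2 * k ≤ N)
    (hN2 : k = 1 → N = 2) (hd : 4 ≤ d) (hx : ∀ r < d, x r ≤ N)
    (hb : ∀ r < d, BoundaryBound k N (x r) (e r))
    (hB : ∀ r < d, ∀ s < d, 2 * x r ≤ 2 * x s + B)
    (hB2 : 1 ≤ ∑ r ∈ range d, x r → ∑ r ∈ range d, x r + 1 ≤ N * d → 2 ≤ B) :
    BoundaryBound (k + 2) (N * d) (∑ r ∈ range d, x r) (B + ∑ r ∈ range d, e r) := by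
  have hcompl : ∑ r ∈ range d, (N - x r) + ∑ r ∈ range d, x r = N * d := by
    rw [← sum_add_distrib, sum_congr rfl (g := fun _ => N) fun r hr =>
      Nat.sub_add_cancel (hx r (mem_range.1 hr))]
    simp [mul_comm]
  by_cases hfull : ∀ r < d, x r + 1 ≤ N
  · refine step_of_not_full hk hN hd hfull hb hB fun h => hB2 h ?_
    have : ∑ r ∈ range d, 1 ≤ ∑ r ∈ range d, (N - x r) :=
      sum_le_sum fun r hr => by have := hfull r (mem_range.1 hr); omega
    rw [sum_const, card_range, smul_eq_mul, mul_one] at this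
    omega
  by_cases hempty : ∀ r < d, 1 ≤ x r
  · refine (step_of_not_full (x := fun r => N - x r) hk hN hd
      (fun r hr => by have := hempty r hr; omega)
      (fun r hr => (hb r hr).compl (by have := hx r hr; omega))
      (fun r hr s hs => by
        have := hB s hs r hr
        have := hx r hr
        have := hx s hs
        omega) (fun h => hB2 ?_ ?_)).compl (by omega)
    · have : ∑ r ∈ range d, 1 ≤ ∑ r ∈ range d, x r :=
        sum_le_sum fun r hr => hempty r (mem_range.1 hr)
      rw [sum_const, card_range, smul_eq_mul, mul_one] at this
      omega
    · omega
  push Not at hfull hempty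
  obtain ⟨r, hr, hrN⟩ := hfull
  obtain ⟨s, hs, hs0⟩ := hempty
  have hBN := hB r hr s hs
  -- A full and an empty class give `B ≥ 2N ≥ 4k`. This suffices except for triples with `k = 1`,
  -- where one more edge is needed: without it every class would be full or empty, of even size as
  -- `N = 2`.
  refine ⟨by omega, by omega, fun h3 => ?_, by omega⟩
  by_cases hk2 : 2 ≤ k
  · omega
  obtain rfl : k = 1 := by omega
  obtain rfl : N = 2 := hN2 rfl
  suffices h : 1 ≤ ∑ r ∈ range d, e r by omega
  by_contra he
  have hpar : ∀ r ∈ range d, 2 ∣ x r := fun r hr => by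
    have h1 := (hb r (mem_range.1 hr)).one
    have h2 := hx r (mem_range.1 hr)
    have h3 := single_le_sum (f := e) (fun _ _ => Nat.zero_le _) hr
    omega
  have := dvd_sum hpar
  omega

theorem boundaryBound_circulantBoundary {c d L k₀ : ℕ} (hd : 4 ≤ d)
    (hc : c = 2 ∧ L = 1 ∧ k₀ = 1 ∨ 4 ≤ c ∧ L = c ∧ k₀ = 2) (m : ℕ) {X : ℕ → Bool}
    (hX : ∀ j, X (j + c * d ^ m) = X j) :
    BoundaryBound (2 * m + k₀) (c * d ^ m) (periodCard (c * d ^ m) X)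
      (circulantBoundary c d L m X) := by
  induction m generalizing X with
  | zero =>
    rw [pow_zero, mul_one] at hX ⊢
    have hle := periodCard_le c X
    have key : 1 ≤ periodCard c X → periodCard c X + 1 ≤ c →
        k₀ ≤ circulantBoundary c d L 0 X := by
      intro h1 h2
      have h := two_le_flips hX h1 h2
      -- For `c = 2` a full period counts the single edge twice, and `L = 1` keeps one copy.
      rcases hc with ⟨rfl, rfl, rfl⟩ | ⟨hc, rfl, rfl⟩
      · have h02 := hX 0
        simp only [circulantBoundary, flips, sum_range_succ, sum_range_zero, zero_add,
          one_add_one_eq_two] at h h02 ⊢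
        rw [h02, Bool.xor_comm (X 1)] at h
        omega
      · exact h
    exact ⟨by omega, by omega, by omega, by omega⟩
  | succ m ih =>
    have hN : 2 * (2 * m + k₀) ≤ c * d ^ m := by
      have h4 : 2 * m + 1 ≤ 4 ^ m := by
        clear ih hX
        induction m with
        | zero => simp
        | succ m ih => rw [pow_succ]; omega
      have hck : 2 * k₀ ≤ c := by omega
      calc 2 * (2 * m + k₀) ≤ 2 * k₀ * (2 * m + 1) := by
            rcases hc with ⟨-, -, rfl⟩ | ⟨-, -, rfl⟩ <;> omega
        _ ≤ c * d ^ m := Nat.mul_le_mul hck (h4.trans (Nat.pow_le_pow_left hd m))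
    have hpow : c * d ^ (m + 1) = c * d ^ m * d := by ring
    rw [hpow] at hX
    rw [circulantBoundary, hpow]
    have hper : ∀ r j, X (d * (j + c * d ^ m) + r) = X (d * j + r) := fun r j => by
      rw [← hX (d * j + r), show d * (j + c * d ^ m) + r = d * j + r + c * d ^ m * d by ring]
    rw [periodCard_mul, show 2 * (m + 1) + k₀ = 2 * m + k₀ + 2 by ring]
    refine BoundaryBound.step (by omega) hN ?_ hd (fun r _ => periodCard_le _ _)
      (fun r _ => ih (hper r)) (fun r hr s hs => two_mul_periodCard_class_le hX hr hs) ?_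
    · intro h
      obtain ⟨rfl, rfl⟩ : m = 0 ∧ c = 2 := by omega
      simp
    · rw [← periodCard_mul]
      exact two_le_flips hX

end Isoperimetry

/-! ### Transfer to the recursive circulant graph -/

section RecursiveCirculant

open Finset

variable {c d m : ℕ}

theorem clog_mul_pow (hc : 1 < c) (hcd : c < d) : Nat.clog d (c * d ^ m) = m + 1 := by
  have hd : 1 < d := by omega
  have hpos : 0 < d ^ m := Nat.pow_pos (by omega)
  refine le_antisymm ?_ ?_
  · rw [Nat.clog_le_iff_le_pow hd, pow_succ, mul_comm]
    exact Nat.mul_le_mul_left _ hcd.le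
  · rw [Nat.succ_le_iff, Nat.lt_clog_iff_pow_lt hd]
    nlinarith

theorem recursiveCirculant_adj (hc : 1 < c) (hcd : c < d) {u v : Fin (c * d ^ m)} :
    (recursiveCirculant (c * d ^ m) d).Adj u v ↔ u ≠ v ∧ ∃ i < m + 1,
      ((u : ℕ) + d ^ i ≡ v [MOD c * d ^ m] ∨ (v : ℕ) + d ^ i ≡ u [MOD c * d ^ m]) := by
  rw [recursiveCirculant, SimpleGraph.fromRel_adj, clog_mul_pow hc hcd]
  constructor
  · rintro ⟨h, ⟨i, hi, h'⟩ | ⟨i, hi, h'⟩⟩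
    exacts [⟨h, i, hi, Or.inl h'⟩, ⟨h, i, hi, Or.inr h'⟩]
  · rintro ⟨h, i, hi, h' | h'⟩
    exacts [⟨h, Or.inl ⟨i, hi, h'⟩⟩, ⟨h, Or.inr ⟨i, hi, h'⟩⟩]

/-- The edge `{j, j + d ^ i}` determines `(i, j)`. A reversed coincidence forces `n ∣ d ^ i + d ^
i'`, hence `n = 2 * d ^ m` and `i = i' = m`; the restriction to `j < d ^ m` excludes it. -/
theorem pow_index_eq {n i i' j j' L : ℕ} (hd : 2 ≤ d) (hi : i ≤ m) (hi' : i' ≤ m)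
    (hn : n = c * d ^ m) (hc : c = 2 ∧ L = 1 ∨ 3 ≤ c)
    (hj : j < n) (hj' : j' < n) (hjL : i = m → j < L * d ^ m) (hjL' : i' = m → j' < L * d ^ m)
    (h : j = j' ∧ j + d ^ i ≡ j' + d ^ i' [MOD n] ∨
      j ≡ j' + d ^ i' [MOD n] ∧ j + d ^ i ≡ j' [MOD n]) : i = i' ∧ j = j' := by
  have hpi : d ^ i ≤ d ^ m := Nat.pow_le_pow_right (by omega) hi
  have hpi' : d ^ i' ≤ d ^ m := Nat.pow_le_pow_right (by omega) hi'
  have hpos : 0 < d ^ i := Nat.pow_pos (by omega)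
  have hpos' : 0 < d ^ i' := Nat.pow_pos (by omega)
  have h2 : 2 * d ^ m ≤ n := hn ▸ Nat.mul_le_mul_right _ (by omega)
  rcases h with ⟨rfl, h⟩ | ⟨ha, hb⟩
  · have := Nat.ModEq.add_left_cancel' j h
    exact ⟨Nat.pow_right_injective hd (this.eq_of_lt_of_lt (by omega) (by omega)), rfl⟩
  · exfalso
    have hsum : n ∣ d ^ i' + d ^ i := by
      have h1 : j' + (d ^ i' + d ^ i) ≡ j' + 0 [MOD n] := by
        rw [← add_assoc]
        exact (ha.symm.add_right _).trans hb
      exact (Nat.modEq_zero_iff_dvd).1 (Nat.ModEq.add_left_cancel' j' h1)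
    have hle := Nat.le_of_dvd (by omega) hsum
    have e1 : d ^ i = d ^ m := by omega
    have e2 : d ^ i' = d ^ m := by omega
    have hne : n = 2 * d ^ m := by omega
    have hi1 := Nat.pow_right_injective hd e1
    have hi2 := Nat.pow_right_injective hd e2
    have hc2 : c = 2 := by
      rw [hn] at hne
      exact Nat.eq_of_mul_eq_mul_right (by omega) hne
    have hL : L = 1 := by omega
    have k1 := hjL hi1
    have k2 := hjL' hi2
    rw [hL, one_mul] at k1 k2
    have := ha.eq_of_lt_of_lt hj (by omega)
    omega

/-- The indicator of `X`, extended periodically. -/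
noncomputable def periodicIndicator {n : ℕ} (hn : 0 < n) (X : Set (Fin n)) (j : ℕ) : Bool :=
  open Classical in decide ((⟨j % n, Nat.mod_lt _ hn⟩ : Fin n) ∈ X)

theorem periodicIndicator_add {n : ℕ} (hn : 0 < n) (X : Set (Fin n)) (j : ℕ) :
    periodicIndicator hn X (j + n) = periodicIndicator hn X j := by
  simp [periodicIndicator]

theorem periodCard_periodicIndicator {n : ℕ} (hn : 0 < n) (X : Set (Fin n)) :
    periodCard n (periodicIndicator hn X) = X.ncard := by
  classical
  rw [periodCard, sum_range, Set.ncard_eq_toFinset_card', card_eq_sum_ones,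
    ← sum_filter_add_sum_filter_not univ (· ∈ X)]
  rw [sum_congr rfl (g := fun _ => 1),
    sum_congr (s₁ := filter (· ∉ X) univ) rfl (g := fun _ => 0)]
  · simp
  · intro x hx
    simpa [periodicIndicator, Nat.mod_eq_of_lt x.2] using hx
  · intro x hx
    simpa [periodicIndicator, Nat.mod_eq_of_lt x.2] using hx

theorem circulantBoundary_le_ncard {L : ℕ} (hc : 1 < c) (hcd : c < d)
    (hcL : c = 2 ∧ L = 1 ∨ 3 ≤ c ∧ L = c) (hn : 0 < c * d ^ m) (X : Set (Fin (c * d ^ m))) :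
    circulantBoundary c d L m (periodicIndicator hn X) ≤
      (edgeBoundary (recursiveCirculant (c * d ^ m) d) X).ncard := by
  classical
  set χ := periodicIndicator hn X with hχ
  let l : ℕ → ℕ := fun i => if i = m then L * d ^ m else (c * d ^ m)
  have hl : ∀ i, l i ≤ c * d ^ m := fun i => by
    by_cases h : i = m
    · simp only [l, h, if_true]
      exact Nat.mul_le_mul_right _ (by omega)
    · simp [l, h]
  let p : ℕ → Fin (c * d ^ m) := fun j => ⟨j % (c * d ^ m), Nat.mod_lt _ hn⟩
  have hp : ∀ j j', p j = p j' ↔ j ≡ j' [MOD c * d ^ m] := fun j j' => by simp [p, Nat.ModEq]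
  let I : Finset (Σ _ : ℕ, ℕ) :=
    (range (m + 1)).sigma fun i => (range (l i)).filter fun j => χ j ≠ χ (j + d ^ i)
  have hI : circulantBoundary c d L m χ = #I := by
    rw [circulantBoundary_eq_sum, card_sigma, sum_range_succ]
    have hf : ∀ s N, flips s N χ = #((range N).filter fun j => χ j ≠ χ (j + s)) := by
      intro s N
      rw [flips, card_filter]
      exact sum_congr rfl fun j _ => by cases χ j <;> cases χ (j + s) <;> rfl
    congr 1
    · refine sum_congr rfl fun i hi => ?_
      rw [hf]
      simp [l, (mem_range.1 hi).ne]
    · rw [hf]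
      simp [l]
  let f : (Σ _ : ℕ, ℕ) → Sym2 (Fin (c * d ^ m)) := fun q => s(p q.2, p (q.2 + d ^ q.1))
  have hmem : ∀ q ∈ I, q.1 ≤ m ∧ q.2 < l q.1 ∧ χ q.2 ≠ χ (q.2 + d ^ q.1) := by
    intro q hq
    rw [mem_sigma, mem_filter, mem_range, mem_range] at hq
    exact ⟨by omega, hq.2⟩
  have hinj : Set.InjOn f I := by
    rintro ⟨i, j⟩ hq ⟨i', j'⟩ hq' h
    obtain ⟨hi, hj, -⟩ := hmem _ hq
    obtain ⟨hi', hj', -⟩ := hmem _ hq'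
    simp only [f] at h hi hj hi' hj'
    have hjn := hj.trans_le (hl _)
    have hjn' := hj'.trans_le (hl _)
    have := pow_index_eq (c := c) (d := d) (m := m) (n := c * d ^ m) (L := L) (by omega) hi hi' rfl
      (by tauto) hjn hjn' (fun h => by simpa [l, h] using hj) (fun h => by simpa [l, h] using hj')
      (by
        rw [Sym2.eq_iff, hp, hp, hp, hp] at h
        exact h.imp_left fun h => ⟨h.1.eq_of_lt_of_lt hjn hjn', h.2⟩)
    obtain ⟨rfl, rfl⟩ := this
    rfl
  rw [hI, ← card_image_of_injOn hinj, ← Set.ncard_coe_finset]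
  refine Set.ncard_le_ncard ?_
  intro e he
  rw [coe_image] at he
  obtain ⟨⟨i, j⟩, hq, rfl⟩ := he
  obtain ⟨hi, -, hne⟩ := hmem _ hq
  simp only [f] at hi hne ⊢
  have hne' : ¬ (p j ∈ X ↔ p (j + d ^ i) ∈ X) := fun h => hne (by
    rw [hχ]
    simp only [periodicIndicator]
    exact decide_eq_decide.2 h)
  rw [mk_mem_edgeBoundary, recursiveCirculant_adj hc hcd]
  refine ⟨⟨fun h => hne' (by rw [h]), i, by omega, Or.inl ?_⟩, by tauto⟩
  exact ((Nat.mod_modEq j (c * d ^ m)).add_right _).trans (Nat.mod_modEq _ (c * d ^ m)).symm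

theorem ncard_edgeBoundary_singleton_le {k₀ : ℕ} (hc : 1 < c) (hcd : c < d)
    (hk : c = 2 ∧ k₀ = 1 ∨ k₀ = 2) (u : Fin (c * d ^ m)) :
    (edgeBoundary (recursiveCirculant (c * d ^ m) d) {u}).ncard ≤ 2 * m + k₀ := by
  classical
  have hn : 0 < c * d ^ m := u.pos
  let p : ℕ → Fin (c * d ^ m) := fun j => ⟨j % (c * d ^ m), Nat.mod_lt _ hn⟩
  have hp : ∀ (j : ℕ) (v : Fin (c * d ^ m)), j ≡ v [MOD c * d ^ m] → v = p j := fun j v h => by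
    ext
    rw [← Nat.mod_eq_of_lt v.2]
    exact h.symm
  have hle : ∀ i ≤ m, d ^ i ≤ c * d ^ m := fun i hi =>
    (Nat.pow_le_pow_right (by omega) hi).trans (Nat.le_mul_of_pos_left _ (by omega))
  let S : Finset (Sym2 (Fin (c * d ^ m))) :=
    ((range (m + 1)).image fun i => s(u, p (u + d ^ i))) ∪
      ((range (m + k₀ - 1)).image fun i => s(u, p (u + ((c * d ^ m) - d ^ i))))
  have hsub : edgeBoundary (recursiveCirculant (c * d ^ m) d) {u} ⊆ S := by
    rintro _ ⟨a, rfl, v, -, hav, rfl⟩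
    obtain ⟨-, i, hi, h | h⟩ := (recursiveCirculant_adj hc hcd).1 hav
    · refine mem_coe.2 (mem_union_left _ (mem_image.2 ⟨i, mem_range.2 hi, ?_⟩))
      rw [← hp _ _ h]
    · have h' : (a : ℕ) + ((c * d ^ m) - d ^ i) ≡ v [MOD c * d ^ m] := by
        have h1 := h.symm.add_right ((c * d ^ m) - d ^ i)
        rw [add_assoc, Nat.add_sub_cancel' (hle i (by omega))] at h1
        exact h1.trans (by simp [Nat.ModEq])
      by_cases him : i < m + k₀ - 1
      · refine mem_coe.2 (mem_union_right _ (mem_image.2 ⟨i, mem_range.2 him, ?_⟩))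
        rw [← hp _ _ h']
      -- For `c = 2` the steps `d ^ m` and `-d ^ m` agree, so this backward neighbour is already
      -- listed as a forward one.
      · obtain rfl : i = m := by omega
        have hc2 : c = 2 := by omega
        refine mem_coe.2 (mem_union_left _ (mem_image.2 ⟨i, mem_range.2 hi, ?_⟩))
        have hs : c * d ^ i - d ^ i = d ^ i := by
          rw [hc2]
          omega
        rw [hs] at h'
        rw [← hp _ _ h']
  calc (edgeBoundary (recursiveCirculant (c * d ^ m) d) {u}).ncard
      ≤ (S : Set (Sym2 (Fin (c * d ^ m)))).ncard :=
        Set.ncard_le_ncard hsub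
    _ = #S := Set.ncard_coe_finset S
    _ ≤ (m + 1) + (m + k₀ - 1) := (card_union_le _ _).trans (Nat.add_le_add
        (card_image_le.trans (card_range _).le) (card_image_le.trans (card_range _).le))
    _ ≤ 2 * m + k₀ := by omega

theorem recursiveCirculant_isSuper_two_and_isPersistence_one {L k₀ : ℕ} (hc : 1 < c) (hcd : c < d)
    (hd : 4 ≤ d) (hm : 2 ≤ m) (hcL : c = 2 ∧ L = 1 ∧ k₀ = 1 ∨ 4 ≤ c ∧ L = c ∧ k₀ = 2) :
    IsSuper (recursiveCirculant (c * d ^ m) d) 2 ∧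
      IsPersistence (recursiveCirculant (c * d ^ m) d) 1 (2 * m + k₀ - 1) := by
  have hn : 9 ≤ c * d ^ m := by
    have h1 : 4 ^ 2 ≤ d ^ m := (Nat.pow_le_pow_left hd 2).trans
      (Nat.pow_le_pow_right (by omega) hm)
    nlinarith
  have hpos : 0 < c * d ^ m := by omega
  have hcard : Nat.card (Fin (c * d ^ m)) = c * d ^ m := Nat.card_fin _
  have key : ∀ X : Set (Fin (c * d ^ m)), BoundaryBound (2 * m + k₀) (c * d ^ m) X.ncard
      (circulantBoundary c d L m (periodicIndicator hpos X)) := fun X => by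
    rw [← periodCard_periodicIndicator hpos X]
    exact boundaryBound_circulantBoundary hd hcL m (periodicIndicator_add hpos X)
  have hle := circulantBoundary_le_ncard (m := m) (L := L) hc hcd (by omega) hpos
  have hk : 5 ≤ 2 * m + k₀ := by omega
  have hdeg := ncard_edgeBoundary_singleton_le (m := m) (k₀ := k₀) hc hcd (by omega)
  have h1 : ∀ X : Set (Fin (c * d ^ m)), 1 ≤ X.ncard → X.ncard + 1 ≤ Nat.card (Fin (c * d ^ m)) →
      2 * m + k₀ ≤ (edgeBoundary (recursiveCirculant (c * d ^ m) d) X).ncard := fun X ha hb =>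
    ((key X).one ha (by omega)).trans (hle X)
  have h3 : ∀ X : Set (Fin (c * d ^ m)), X.ncard = 3 →
      3 * (2 * m + k₀) ≤ (edgeBoundary (recursiveCirculant (c * d ^ m) d) X).ncard + 4 :=
    fun X ha => by
      have := (key X).three (Or.inl ha)
      have := hle X
      omega
  have h4 : ∀ X : Set (Fin (c * d ^ m)), 4 ≤ X.ncard → X.ncard + 4 ≤ Nat.card (Fin (c * d ^ m)) →
      3 * (2 * m + k₀) ≤ (edgeBoundary (recursiveCirculant (c * d ^ m) d) X).ncard + 3 :=
    fun X ha hb => by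
      have := (key X).four ha (by omega)
      have := hle X
      omega
  exact ⟨isSuper_two_of_isoperimetric hk hdeg h1 h4 (by omega),
    isPersistence_one_of_isoperimetric hk hdeg h1 h3 h4 (by omega)⟩

end RecursiveCirculant

end ExtraEdge

theorem mainTheorem11 (c d m : ℕ) (hc : 1 < c) (hcd : c < d) (hc3 : c ≠ 3) (hd : 4 ≤ d)
    (hm : 2 ≤ m) :
    ExtraEdge.IsSuper (recursiveCirculant (c * d ^ m) d) 2 ∧
      (c = 2 → ExtraEdge.IsPersistence (recursiveCirculant (c * d ^ m) d) 1 (2 * m)) ∧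
      (4 ≤ c → ExtraEdge.IsPersistence (recursiveCirculant (c * d ^ m) d) 1 (2 * m + 1)) := by
  by_cases h2 : c = 2
  · have := ExtraEdge.recursiveCirculant_isSuper_two_and_isPersistence_one hc hcd hd hm
      (Or.inl ⟨h2, rfl, rfl⟩)
    exact ⟨this.1, fun _ => this.2, fun h => by omega⟩
  · have := ExtraEdge.recursiveCirculant_isSuper_two_and_isPersistence_one hc hcd hd hm
      (Or.inr ⟨by omega, rfl, rfl⟩)
    exact ⟨this.1, fun h => absurd h h2, fun _ => this.2⟩
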